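/- Let $\mathcal{E}$ be a finite-dimensional real Euclidean space and let $\mathcal{K} \subseteq \mathcal{E}$ be a (nonempty) closed convex cone; $\dim \mathcal{K}$ denotes the dimension of its linear span. A \emph{face} of $\mathcal{K}$ is a nonempty closed convex subset $\mathcal{F} \subseteq \mathcal{K}$ such that whenever $x, y \in \mathcal{K}$ and $\alpha x + (1-\alpha) y \in \mathcal{F}$ for some $\alpha \in (0,1)$, then $x, y \in \mathcal{F}$. The cone $\mathcal{K}$ is \emph{amenable} if for every face $\mathcal{F}$ of $\mathcal{K}$ there is a constant $\kappa > 0$ (possibly depending on $\mathcal{F}$) such that $\operatorname{dist}(x, \mathcal{F}) \le \kappa \operatorname{dist}(x, \mathcal{K})$ for all $x \in \operatorname{span} \mathcal{F}$. It is \emph{projectionally exposed} if for every face $\mathcal{F}$ of $\mathcal{K}$ there is an idempotent linear map $P : \mathcal{E} \to \mathcal{E}$ with $P(\mathcal{K}) = \mathcal{F}$. If $\dim \mathcal{K} \le 4$, then $\mathcal{K}$ is amenable if and only if it is projectionally exposed. Consequently, if $\mathcal{K}$ is amenable but not projectionally exposed, then $\dim \mathcal{K} \ge 5$. -/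

import Mathlib

namespace AmenableCones

variable {E : Type*} [NormedAddCommGroup E] [InnerProductSpace ℝ E]

/-- `F` is a (nonempty) face of the convex set `C`: a nonempty closed convex subset of `C` such that
whenever a point of `F` lies in the open segment between two points `x, y` of `C`, both `x` and `y`
belong to `F` (this last condition, with `F ⊆ C`, is `IsExtreme ℝ C F`). -/
structure IsFace (C F : Set E) : Prop where
  nonempty : F.Nonempty
  isClosed : IsClosed F
  convex : Convex ℝ F
  isExtreme : IsExtreme ℝ C F

/-- A closed convex cone `K` is amenable if for every face `F` of `K` there is `κ > 0` with
`dist(x, F) ≤ κ dist(x, K)` for all `x` in the linear span of `F`. -/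
def IsAmenable (K : ProperCone ℝ E) : Prop :=
  ∀ F : Set E, IsFace (K : Set E) F →
    ∃ κ : ℝ, 0 < κ ∧ ∀ x ∈ Submodule.span ℝ F,
      Metric.infDist x F ≤ κ * Metric.infDist x (K : Set E)

/-- A closed convex cone `K` is projectionally exposed if every face of `K` is the image of `K`
under some idempotent linear map of the ambient space (a not necessarily orthogonal projection). -/
def IsProjectionallyExposed (K : ProperCone ℝ E) : Prop :=
  ∀ F : Set E, IsFace (K : Set E) F →
    ∃ P : E →ₗ[ℝ] E, P ∘ₗ P = P ∧ P '' (K : Set E) = F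

/-- The dimension of a closed convex cone: the dimension of its affine hull (which, as the cone
contains the origin, is its linear span). -/
noncomputable def coneDim (K : ProperCone ℝ E) : ℕ :=
  Module.finrank ℝ (Submodule.span ℝ (K : Set E))

end AmenableCones

/-!
A projection `P` with `P '' K = F` fixes `span F` and is Lipschitz, so for `x ∈ span F` the image
under `P` of the point of `K` nearest to `x` is a point of `F` at distance at most
`‖P‖ * infDist x K`; thus projectionally exposed cones are amenable in every dimension.

For the converse in dimension at most four, two kinds of faces `F` of an amenable cone `K` are shown
to be images of `K` under projections.

* The quotient of `F` by its lineality space has dimension at most two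
  (`exists_projection_of_finrank_pointedPart_le`). Then `F` is the sum of its lineality space and a
  simplicial cone, so it is described by coordinate functionals which are nonnegative on `F`
  (`exists_nonneg_coordinates`). Amenability and the Hahn-Banach theorem extend these functionals
  from `span F` to functionals which are nonnegative on `K` (`exists_nonneg_extension`), and the
  extended coordinates define the projection.
* `F` has codimension at most one in `K` (`exists_projection_of_finrank_le_succ`). In codimension
  one, with `h` the functional defining the hyperplane `span F`, normalised at a point `w` of `K`,
  the projection is `x ↦ x - h x • (w - t • u)` with `u` in the relative interior of `F`;
  amenability makes one `t` large enough for all points of `K`.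

If `F` is not of the first kind then `dim F ≥ 3`, so `dim K ≤ 4` makes it of the second kind.
-/

namespace AmenableCones

variable {E : Type*} [NormedAddCommGroup E] [InnerProductSpace ℝ E]

/-! ### Faces of a cone -/

/-- A face of a closed convex cone is itself a closed convex cone: a point `x` of the face is the
midpoint of `0` and `2 • x`, and lies between `0` and every larger multiple of itself. -/
lemma IsFace.exists_properCone {K : ProperCone ℝ E} {F : Set E} (hF : IsFace (K : Set E) F) :
    ∃ G : ProperCone ℝ E, (G : Set E) = F := by
  have hsub := hF.isExtreme.subset
  have hzero : (0 : E) ∈ F := by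
    obtain ⟨x, hx⟩ := hF.nonempty
    refine hF.isExtreme.left_mem_of_mem_openSegment (zero_mem K)
      (K.smul_mem (hsub hx) (zero_le_two : (0 : ℝ) ≤ 2)) hx
      ⟨1 / 2, 1 / 2, by norm_num, by norm_num, by norm_num, ?_⟩
    rw [smul_zero, zero_add, smul_smul]
    norm_num
  have hsmul : ∀ r : ℝ, 0 ≤ r → ∀ x ∈ F, r • x ∈ F := by
    intro r hr x hx
    rcases le_or_gt r 1 with h1 | h1
    · have := hF.convex hx hzero hr (sub_nonneg.2 h1) (by ring)
      simpa using this
    · refine hF.isExtreme.left_mem_of_mem_openSegment (K.smul_mem (hsub hx) hr) (zero_mem K) hx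
        ⟨r⁻¹, 1 - r⁻¹, by positivity, sub_pos.2 (inv_lt_one_of_one_lt₀ h1), by ring, ?_⟩
      rw [smul_zero, add_zero, smul_smul, inv_mul_cancel₀ (by positivity), one_smul]
  have hadd : ∀ x ∈ F, ∀ y ∈ F, x + y ∈ F := by
    intro x hx y hy
    have := hsmul 2 zero_le_two _ (hF.convex hx hy (by norm_num : (0 : ℝ) ≤ 1 / 2)
      (by norm_num : (0 : ℝ) ≤ 1 / 2) (by norm_num))
    rw [smul_add, smul_smul, smul_smul] at this
    simpa using this
  exact ⟨{ carrier := F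
           add_mem' := fun {x y} hx hy => hadd x hx y hy
           zero_mem' := hzero
           smul_mem' := fun c x hx => hsmul c c.2 x hx
           isClosed' := hF.isClosed }, rfl⟩

/-- In a face of a cone, a sum of two points of the cone has both summands in the face. -/
lemma IsFace.mem_of_add_mem {K : ProperCone ℝ E} {F : Set E} (hF : IsFace (K : Set E) F) {x y : E}
    (hx : x ∈ K) (hy : y ∈ K) (hxy : x + y ∈ F) : x ∈ F := by
  obtain ⟨G, rfl⟩ := hF.exists_properCone
  have h2 : (2 : ℝ) • x ∈ G := by
    refine hF.isExtreme.left_mem_of_mem_openSegment (K.smul_mem hx zero_le_two)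
      (K.smul_mem hy zero_le_two) hxy ⟨1 / 2, 1 / 2, by norm_num, by norm_num, by norm_num, ?_⟩
    rw [smul_smul, smul_smul]
    norm_num
  have := G.smul_mem h2 (by norm_num : (0 : ℝ) ≤ 1 / 2)
  rw [smul_smul] at this
  norm_num at this
  exact this

/-- Every vector in the span of a convex cone is a difference of two vectors of the cone. -/
lemma exists_sub_eq_of_mem_span {G : ProperCone ℝ E} {x : E}
    (hx : x ∈ Submodule.span ℝ (G : Set E)) : ∃ p ∈ G, ∃ q ∈ G, x = p - q := by
  induction hx using Submodule.span_induction with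
  | mem x hx => exact ⟨x, hx, 0, zero_mem G, by simp⟩
  | zero => exact ⟨0, zero_mem G, 0, zero_mem G, by simp⟩
  | add x y _ _ hx hy =>
    obtain ⟨p, hp, q, hq, rfl⟩ := hx
    obtain ⟨p', hp', q', hq', rfl⟩ := hy
    exact ⟨p + p', add_mem hp hp', q + q', add_mem hq hq', by abel⟩
  | smul c x _ hx =>
    obtain ⟨p, hp, q, hq, rfl⟩ := hx
    rcases le_total 0 c with hc | hc
    · exact ⟨c • p, G.smul_mem hp hc, c • q, G.smul_mem hq hc, smul_sub c p q⟩
    · exact ⟨(-c) • q, G.smul_mem hq (neg_nonneg.2 hc), (-c) • p,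
        G.smul_mem hp (neg_nonneg.2 hc), by module⟩

/-- A face contains every point of the cone that lies in the linear span of the face. -/
lemma IsFace.mem_of_mem_span {K : ProperCone ℝ E} {F : Set E} (hF : IsFace (K : Set E) F) {x : E}
    (hx : x ∈ K) (hxF : x ∈ Submodule.span ℝ F) : x ∈ F := by
  obtain ⟨G, rfl⟩ := hF.exists_properCone
  obtain ⟨p, hp, q, hq, rfl⟩ := exists_sub_eq_of_mem_span hxF
  exact hF.mem_of_add_mem hx (hF.isExtreme.subset hq) (by simpa using hp)

/-! ### Projectionally exposed cones are amenable -/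

lemma IsProjectionallyExposed.isAmenable [FiniteDimensional ℝ E] {K : ProperCone ℝ E}
    (hK : IsProjectionallyExposed K) : IsAmenable K := by
  intro F hF
  obtain ⟨P, hP, hPK⟩ := hK F hF
  let Q : E →L[ℝ] E := LinearMap.toContinuousLinearMap P
  have hid : ∀ x ∈ Submodule.span ℝ F, P x = x := by
    intro x hx
    refine LinearMap.eqOn_span' (f := P) (g := LinearMap.id) ?_ hx
    rw [← hPK]
    rintro _ ⟨k, -, rfl⟩
    exact LinearMap.congr_fun hP k
  refine ⟨‖Q‖ + 1, by positivity, fun x hx => ?_⟩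
  obtain ⟨k, hk, hxk⟩ := K.isClosed.exists_infDist_eq_dist K.nonempty x
  calc Metric.infDist x F ≤ dist x (P k) :=
        Metric.infDist_le_dist_of_mem (hPK ▸ Set.mem_image_of_mem P hk)
    _ = ‖Q (x - k)‖ := by
        rw [dist_eq_norm, map_sub]
        congr 2
        exact (hid x hx).symm
    _ ≤ ‖Q‖ * ‖x - k‖ := Q.le_opNorm _
    _ ≤ (‖Q‖ + 1) * ‖x - k‖ := by gcongr; linarith
    _ = (‖Q‖ + 1) * Metric.infDist x (K : Set E) := by rw [hxk, dist_eq_norm]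

/-! ### Extending nonnegative functionals from an amenable face -/

section Distance

variable [FiniteDimensional ℝ E]

lemma infDist_add_le (K : ProperCone ℝ E) (x y : E) :
    Metric.infDist (x + y) (K : Set E) ≤
      Metric.infDist x (K : Set E) + Metric.infDist y (K : Set E) := by
  obtain ⟨a, ha, hxa⟩ := K.isClosed.exists_infDist_eq_dist K.nonempty x
  obtain ⟨b, hb, hyb⟩ := K.isClosed.exists_infDist_eq_dist K.nonempty y
  rw [hxa, hyb]
  exact (Metric.infDist_le_dist_of_mem (add_mem ha hb : a + b ∈ K)).trans (dist_add_add_le _ _ _ _)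

lemma infDist_smul (K : ProperCone ℝ E) {c : ℝ} (hc : 0 < c) (x : E) :
    Metric.infDist (c • x) (K : Set E) = c * Metric.infDist x (K : Set E) := by
  have key : ∀ c : ℝ, 0 < c → ∀ x : E,
      Metric.infDist (c • x) (K : Set E) ≤ c * Metric.infDist x (K : Set E) := by
    intro c hc x
    obtain ⟨a, ha, hxa⟩ := K.isClosed.exists_infDist_eq_dist K.nonempty x
    calc Metric.infDist (c • x) (K : Set E) ≤ dist (c • x) (c • a) :=
          Metric.infDist_le_dist_of_mem (K.smul_mem ha hc.le)
      _ = c * Metric.infDist x (K : Set E) := by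
          rw [dist_smul₀, Real.norm_of_nonneg hc.le, hxa]
  refine le_antisymm (key c hc x) ?_
  have h := key c⁻¹ (inv_pos.2 hc) (c • x)
  rw [smul_smul, inv_mul_cancel₀ hc.ne', one_smul] at h
  rwa [inv_mul_eq_div, le_div_iff₀' hc] at h

/-- The dual description of amenability (one speaks of a *nice* cone): a functional that is
nonnegative on an amenable face `F` agrees on the span of `F` with a functional that is
nonnegative on all of `K`. On `span F` the negated functional is bounded by a multiple of the
distance to `F`, hence by a multiple of the distance to `K`; the latter is sublinear on `E` and
vanishes on `K`, so Hahn-Banach applies. -/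
lemma exists_nonneg_extension {K F : ProperCone ℝ E} {κ : ℝ} (hκ₀ : 0 ≤ κ)
    (hκ : ∀ x ∈ Submodule.span ℝ (F : Set E),
      Metric.infDist x (F : Set E) ≤ κ * Metric.infDist x (K : Set E))
    (f : E →ₗ[ℝ] ℝ) (hf : ∀ x ∈ F, 0 ≤ f x) :
    ∃ g : E →ₗ[ℝ] ℝ, (∀ x ∈ K, 0 ≤ g x) ∧ ∀ x ∈ Submodule.span ℝ (F : Set E), g x = f x := by
  let φ : E →L[ℝ] ℝ := LinearMap.toContinuousLinearMap f
  have hbound : ∀ x ∈ Submodule.span ℝ (F : Set E),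
      -f x ≤ ‖φ‖ * κ * Metric.infDist x (K : Set E) := by
    intro x hx
    obtain ⟨z, hz, hxz⟩ := F.isClosed.exists_infDist_eq_dist F.nonempty x
    have h1 : -f x ≤ ‖φ‖ * ‖x - z‖ := by
      have h2 : -φ (x - z) ≤ ‖φ (x - z)‖ := neg_le_abs _
      have h3 : φ (x - z) = f x - f z := map_sub f x z
      have := hf z hz
      have := φ.le_opNorm (x - z)
      linarith
    calc -f x ≤ ‖φ‖ * Metric.infDist x (F : Set E) := by rwa [hxz, dist_eq_norm]
      _ ≤ ‖φ‖ * (κ * Metric.infDist x (K : Set E)) := by gcongr; exact hκ x hx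
      _ = _ := by ring
  obtain ⟨g, hg, hgle⟩ := exists_extension_of_le_sublinear
    ⟨Submodule.span ℝ (F : Set E), (-f).domRestrict _⟩
    (fun x => ‖φ‖ * κ * Metric.infDist x (K : Set E))
    (fun c hc x => by rw [infDist_smul K hc]; ring)
    (fun x y => by
      rw [← mul_add]
      gcongr
      exact infDist_add_le K x y) (fun x => hbound x x.2)
  refine ⟨-g, fun x hx => ?_, fun x hx => ?_⟩
  · have := hgle x
    simp only [Metric.infDist_zero_of_mem (show x ∈ (K : Set E) from hx), mul_zero] at this
    simpa using this
  · have h : g x = -f x := hg ⟨x, hx⟩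
    simp [h]

end Distance

/-! ### Coordinates with respect to a spanning set -/

/-- Coordinate functionals, defined on the whole space, for a basis of `span s` chosen in `s`. -/
lemma exists_coordinates [FiniteDimensional ℝ E] (s : Set E) :
    ∃ (v : Fin (Module.finrank ℝ (Submodule.span ℝ s)) → E)
      (f : Fin (Module.finrank ℝ (Submodule.span ℝ s)) → E →ₗ[ℝ] ℝ),
      (∀ i, v i ∈ s) ∧ (∀ i j, f i (v j) = if i = j then 1 else 0) ∧
        ∀ x ∈ Submodule.span ℝ s, ∑ i, f i x • v i = x := by
  obtain ⟨v, hv, hspan, hli⟩ := Submodule.exists_fun_fin_finrank_span_eq ℝ s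
  obtain ⟨g, hg⟩ := (Fintype.linearCombination ℝ v).exists_leftInverse_of_injective
    (LinearMap.ker_eq_bot.2 (linearIndependent_iff_injective_fintypeLinearCombination.1 hli))
  have hgv : ∀ j, g (v j) = Pi.single j 1 := by
    intro j
    have := LinearMap.congr_fun hg (Pi.single j 1)
    simpa using this
  refine ⟨v, fun i => LinearMap.proj i ∘ₗ g, hv, fun i j => ?_, fun x hx => ?_⟩
  · simp [hgv, Pi.single_apply]
  · rw [← hspan, ← Fintype.range_linearCombination] at hx
    obtain ⟨c, rfl⟩ := hx
    have : g (Fintype.linearCombination ℝ v c) = c := LinearMap.congr_fun hg c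
    simp only [LinearMap.comp_apply, this, LinearMap.proj_apply]
    rfl

/-! ### Pointed cones of dimension at most two -/

/-- From a point `w` of a closed cone one can move only finitely far in the direction `-u` unless
`-u` lies in the cone; the furthest point reached is still in the cone. -/
lemma exists_maximal_sub_smul_mem {C : ProperCone ℝ E} {u w : E} (hw : w ∈ C) (hu : -u ∉ C) :
    ∃ t : ℝ, 0 ≤ t ∧ w - t • u ∈ C ∧ ∀ t' > t, w - t' • u ∉ C := by
  let S : Set ℝ := {t | w - t • u ∈ C}
  have hSc : IsClosed S := C.isClosed.preimage (by fun_prop : Continuous fun t : ℝ => w - t • u)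
  have h0 : (0 : ℝ) ∈ S := by simpa [S] using hw
  have hbdd : BddAbove S := by
    have hopen : IsOpen {r : ℝ | r • w - u ∈ C}ᶜ :=
      (C.isClosed.preimage (by fun_prop : Continuous fun r : ℝ => r • w - u)).isOpen_compl
    obtain ⟨ε, hε, hball⟩ := Metric.isOpen_iff.1 hopen 0 (by simpa using hu)
    refine ⟨ε⁻¹, fun t ht => ?_⟩
    by_contra! hlt
    have htpos : 0 < t := (inv_pos.2 hε).trans hlt
    refine hball (?_ : t⁻¹ ∈ Metric.ball (0 : ℝ) ε) ?_
    · rw [Metric.mem_ball, dist_zero_right, Real.norm_of_nonneg (by positivity)]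
      exact inv_lt_of_inv_lt₀ hε hlt
    · have := C.smul_mem ht (inv_nonneg.2 htpos.le)
      rwa [smul_sub, smul_smul, inv_mul_cancel₀ htpos.ne', one_smul] at this
  have hmem := hSc.csSup_mem ⟨0, h0⟩ hbdd
  exact ⟨sSup S, le_csSup hbdd h0, hmem, fun t' ht' h => (le_csSup hbdd h).not_gt ht'⟩

lemma mem_of_smul_mem {C : ProperCone ℝ E} {c : ℝ} (hc : 0 < c) {x : E} (h : c • x ∈ C) :
    x ∈ C := by
  have := C.smul_mem h (inv_nonneg.2 hc.le)
  rwa [smul_smul, inv_mul_cancel₀ hc.ne', one_smul] at this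

/-- A closed pointed cone of dimension at most two is simplicial: on its span every vector is
a combination of finitely many vectors of the cone, with coefficients that are linear functionals
nonnegative on the cone. In dimension two, `a` and `b` span the two extreme rays; they are found
by moving from one vector of the cone in the direction opposite to another as far as possible. -/
lemma exists_nonneg_coordinates [FiniteDimensional ℝ E] (C : ProperCone ℝ E)
    (hpt : ∀ x ∈ C, -x ∈ C → x = 0)
    (hdim : Module.finrank ℝ (Submodule.span ℝ (C : Set E)) ≤ 2) :
    ∃ (n : ℕ) (v : Fin n → E) (f : Fin n → E →ₗ[ℝ] ℝ), (∀ i, v i ∈ C) ∧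
      (∀ i, ∀ x ∈ C, 0 ≤ f i x) ∧ ∀ x ∈ C, ∑ i, f i x • v i = x := by
  obtain ⟨v, f, hv, hfv, hsum⟩ := exists_coordinates (C : Set E)
  replace hsum := fun x (hx : x ∈ C) => hsum x (Submodule.subset_span hx)
  generalize Module.finrank ℝ (Submodule.span ℝ (C : Set E)) = n at hdim v f
  interval_cases n
  · exact ⟨0, v, f, hv, fun i => i.elim0, hsum⟩
  · refine ⟨1, v, f, hv, fun i x hx => ?_, hsum⟩
    obtain rfl : i = 0 := Subsingleton.elim _ _
    by_contra! hneg
    have hx' := hsum x hx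
    rw [Fin.sum_univ_one] at hx'
    have h1 : -v 0 ∈ C := by
      refine mem_of_smul_mem (neg_pos.2 hneg) ?_
      rwa [neg_smul_neg, hx']
    have h2 := hfv 0 0
    simp [hpt _ (hv 0) h1] at h2
  · have h00 : f 0 (v 0) = 1 := by simp [hfv]
    have h01 : f 0 (v 1) = 0 := by simp [hfv]
    have h10 : f 1 (v 0) = 0 := by simp [hfv]
    have h11 : f 1 (v 1) = 1 := by simp [hfv]
    have hneg : ∀ x ∈ C, ∀ g : E →ₗ[ℝ] ℝ, g x = 1 → -x ∉ C := by
      intro x hx g hgx hn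
      simp [hpt x hx hn] at hgx
    obtain ⟨t, ht, ha, htmax⟩ := exists_maximal_sub_smul_mem (hv 1) (hneg _ (hv 0) (f 0) h00)
    set a := v 1 - t • v 0 with ha_def
    have hna : -a ∉ C := hneg a ha (f 1) (by simp [ha_def, h10, h11])
    obtain ⟨s, hs, hb, hsmax⟩ := exists_maximal_sub_smul_mem (hv 0) hna
    set b := v 0 - s • a with hb_def
    -- the coordinate functionals of the basis `a`, `b`
    let β : E →ₗ[ℝ] ℝ := f 0 + t • f 1
    let α : E →ₗ[ℝ] ℝ := f 1 + s • β
    have hβb : β b = 1 := by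
      simp [β, hb_def, ha_def, h00, h01, h10, h11]
      ring
    have hnb : -b ∉ C := hneg b hb β hβb
    have hab : ∀ x ∈ C, α x • a + β x • b = x := by
      intro x hx
      conv_rhs => rw [← hsum x hx, Fin.sum_univ_two]
      simp only [α, β, hb_def, ha_def, LinearMap.add_apply, LinearMap.smul_apply, smul_eq_mul]
      module
    -- a negative coordinate puts `-a` or `-b` in the cone, or lets one move beyond `s` or `t`
    have hα : ∀ p q : ℝ, p • a + q • b ∈ C → 0 ≤ p := by
      intro p q hpq
      by_contra! hlt
      rcases le_or_gt q 0 with hq | hq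
      · refine hna (mem_of_smul_mem (neg_pos.2 hlt) ?_)
        convert add_mem hpq (C.smul_mem hb (neg_nonneg.2 hq)) using 1
        module
      · refine hsmax (s - p / q) (by linarith [div_neg_of_neg_of_pos hlt hq])
          (mem_of_smul_mem hq ?_)
        convert hpq using 1
        rw [hb_def, smul_sub, smul_smul, mul_sub, mul_div_cancel₀ _ hq.ne']
        module
    have hβ : ∀ p q : ℝ, p • a + q • b ∈ C → 0 ≤ q := by
      intro p q hpq
      by_contra! hlt
      rcases le_or_gt p 0 with hp | hp
      · refine hnb (mem_of_smul_mem (neg_pos.2 hlt) ?_)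
        convert add_mem hpq (C.smul_mem ha (neg_nonneg.2 hp)) using 1
        module
      · have hr : 0 < p - q * s := by nlinarith
        refine htmax (t - q / (p - q * s)) (by linarith [div_neg_of_neg_of_pos hlt hr])
          (mem_of_smul_mem hr ?_)
        convert hpq using 1
        rw [smul_sub, smul_smul, mul_sub, mul_div_cancel₀ _ hr.ne', hb_def, ha_def]
        module
    refine ⟨2, ![a, b], ![α, β], ?_, ?_, ?_⟩
    · intro i
      fin_cases i
      exacts [ha, hb]
    · intro i
      fin_cases i
      exacts [fun x hx => hα _ _ ((hab x hx).symm ▸ hx), fun x hx => hβ _ _ ((hab x hx).symm ▸ hx)]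
    · intro x hx
      simpa [Fin.sum_univ_two] using hab x hx

/-! ### Projections onto faces -/

/-- A linear map sending a cone into a face and fixing the face is a projection exposing it. -/
lemma exists_projection_of_mapsTo {K F : ProperCone ℝ E} (P : E →ₗ[ℝ] E)
    (hFK : (F : Set E) ⊆ K) (hrange : ∀ x, P x ∈ Submodule.span ℝ (F : Set E))
    (hmaps : ∀ x ∈ K, P x ∈ F) (hfix : ∀ x ∈ F, P x = x) :
    ∃ P : E →ₗ[ℝ] E, P ∘ₗ P = P ∧ P '' (K : Set E) = F := by
  refine ⟨P, LinearMap.ext fun x => ?_, Set.Subset.antisymm ?_ ?_⟩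
  · exact LinearMap.eqOn_span' (f := P) (g := LinearMap.id) hfix (hrange x)
  · rintro _ ⟨x, hx, rfl⟩
    exact hmaps x hx
  · exact fun x hx => ⟨x, hFK hx, hfix x hx⟩

/-- The largest linear subspace contained in a closed convex cone. -/
def linealitySpace (F : ProperCone ℝ E) : Submodule ℝ E where
  carrier := {x | x ∈ F ∧ -x ∈ F}
  add_mem' := fun {x y} hx hy => ⟨add_mem hx.1 hy.1, by
    rw [neg_add]
    exact add_mem hx.2 hy.2⟩
  zero_mem' := ⟨zero_mem F, by simp⟩
  smul_mem' := fun c x hx => by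
    rcases le_total 0 c with hc | hc
    · exact ⟨F.smul_mem hx.1 hc, by rw [← smul_neg]; exact F.smul_mem hx.2 hc⟩
    · refine ⟨?_, ?_⟩
      · rw [← neg_smul_neg]
        exact F.smul_mem hx.2 (neg_nonneg.2 hc)
      · rw [← neg_smul]
        exact F.smul_mem hx.1 (neg_nonneg.2 hc)

/-- The part of a closed convex cone orthogonal to its lineality space; it is a closed pointed
cone, and the cone is its sum with the lineality space. -/
def pointedPart (F : ProperCone ℝ E) : ProperCone ℝ E where
  carrier := {x | x ∈ F ∧ x ∈ (linealitySpace F)ᗮ}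
  add_mem' := fun hx hy => ⟨add_mem hx.1 hy.1, add_mem hx.2 hy.2⟩
  zero_mem' := ⟨zero_mem F, zero_mem _⟩
  smul_mem' := fun c _ hx => ⟨F.smul_mem hx.1 c.2, Submodule.smul_mem _ (c : ℝ) hx.2⟩
  isClosed' := F.isClosed.inter (Submodule.isClosed_orthogonal _)

lemma pointedPart_pointed (F : ProperCone ℝ E) (x : E) (hx : x ∈ pointedPart F)
    (hnx : -x ∈ pointedPart F) : x = 0 :=
  Submodule.disjoint_def.1 (linealitySpace F).orthogonal_disjoint x ⟨hx.1, hnx.1⟩ hx.2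

variable [FiniteDimensional ℝ E]

/-- An amenable face whose pointed part has dimension at most two is exposed by a projection:
the nonnegative coordinate functionals of the pointed part extend to functionals nonnegative on
the whole cone. -/
lemma exists_projection_of_finrank_pointedPart_le {K F : ProperCone ℝ E} {κ : ℝ} (hκ₀ : 0 ≤ κ)
    (hFK : (F : Set E) ⊆ K)
    (hκ : ∀ x ∈ Submodule.span ℝ (F : Set E),
      Metric.infDist x (F : Set E) ≤ κ * Metric.infDist x (K : Set E))
    (hdim : Module.finrank ℝ (Submodule.span ℝ (pointedPart F : Set E)) ≤ 2) :
    ∃ P : E →ₗ[ℝ] E, P ∘ₗ P = P ∧ P '' (K : Set E) = F := by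
  obtain ⟨n, v, f, hv, hf, hsum⟩ :=
    exists_nonneg_coordinates (pointedPart F) (pointedPart_pointed F) hdim
  let Q : E →ₗ[ℝ] E := (linealitySpace F).starProjection
  have hQ : ∀ x, Q x ∈ linealitySpace F := fun x => Submodule.starProjection_apply_mem _ x
  have hQv : ∀ i, Q (v i) = 0 := fun i =>
    (Submodule.starProjection_apply_eq_zero_iff _).2 (hv i).2
  have hsub : ∀ x ∈ F, x - Q x ∈ pointedPart F := fun x hx =>
    ⟨by rw [sub_eq_add_neg]; exact add_mem hx (hQ x).2,
      Submodule.sub_starProjection_mem_orthogonal x⟩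
  choose g hg hgf using fun i => exists_nonneg_extension hκ₀ hκ (f i ∘ₗ (LinearMap.id - Q))
    fun x hx => hf i _ (hsub x hx)
  let P : E →ₗ[ℝ] E := Q + ∑ i, (g i).smulRight (v i)
  have hP : ∀ x, P x = Q x + ∑ i, g i x • v i := fun x => by
    simp [P, LinearMap.sum_apply]
  refine exists_projection_of_mapsTo P hFK (fun x => ?_) (fun x hx => ?_) fun x hx => ?_
  · rw [hP]
    exact add_mem (Submodule.subset_span (hQ x).1)
      (sum_mem fun i _ => Submodule.smul_mem _ _ (Submodule.subset_span (hv i).1))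
  · rw [hP]
    exact add_mem (hQ x).1 (sum_mem fun i _ => F.smul_mem (hv i).1 (hg i x hx))
  · rw [hP]
    have h := hsum _ (hsub x hx)
    simp only [hgf _ x (Submodule.subset_span hx), LinearMap.comp_apply, LinearMap.sub_apply,
      LinearMap.id_apply]
    rw [h]
    abel

/-- A closed convex cone has a vector `u` in the relative interior, in the quantitative form that
any vector `s` of the span is brought into the cone by adding `r • u` with `r` at least a fixed
multiple of `‖s‖`. The sum of a basis of the span taken from the cone is such a vector. -/
lemma exists_add_smul_mem (F : ProperCone ℝ E) :
    ∃ u ∈ F, ∃ M : ℝ, 0 ≤ M ∧ ∀ s ∈ Submodule.span ℝ (F : Set E), ∀ r : ℝ, M * ‖s‖ ≤ r →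
      s + r • u ∈ F := by
  obtain ⟨v, f, hv, -, hsum⟩ := exists_coordinates (F : Set E)
  let φ := fun i => LinearMap.toContinuousLinearMap (f i)
  refine ⟨∑ i, v i, sum_mem fun i _ => hv i, ∑ i, ‖φ i‖, by positivity, fun s hs r hr => ?_⟩
  rw [← hsum s hs, Finset.smul_sum, ← Finset.sum_add_distrib]
  refine sum_mem fun i _ => ?_
  rw [← add_smul]
  refine F.smul_mem (hv i) ?_
  have h1 : -(f i s) ≤ ‖φ i‖ * ‖s‖ := (neg_le_abs (f i s)).trans ((φ i).le_opNorm s)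
  have h2 : ‖φ i‖ ≤ ∑ j, ‖φ j‖ :=
    Finset.single_le_sum (f := fun j => ‖φ j‖) (fun j _ => norm_nonneg _) (Finset.mem_univ i)
  have h3 := mul_le_mul_of_nonneg_right h2 (norm_nonneg s)
  linarith

/-- An amenable face of codimension at most one is exposed by a projection. In codimension one,
let `h` be the functional that vanishes on the face and equals `1` at a point `w` of the cone
outside it. Then `x ↦ x - h x • w` maps the cone to within a bounded multiple of `h x` from the
face, by amenability, and adding a large multiple of `h x • u`, with `u` in the relative interior
of the face, moves the image into the face. -/
lemma exists_projection_of_finrank_le_succ {K F : ProperCone ℝ E} {κ : ℝ} (hκ₀ : 0 ≤ κ)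
    (hF : IsFace (K : Set E) F)
    (hκ : ∀ x ∈ Submodule.span ℝ (F : Set E),
      Metric.infDist x (F : Set E) ≤ κ * Metric.infDist x (K : Set E))
    (hdim : coneDim K ≤ coneDim F + 1) :
    ∃ P : E →ₗ[ℝ] E, P ∘ₗ P = P ∧ P '' (K : Set E) = F := by
  set S := Submodule.span ℝ (F : Set E) with hS
  have hFK : (F : Set E) ⊆ K := hF.isExtreme.subset
  have hFS : ∀ x ∈ F, x ∈ S := fun x hx => Submodule.subset_span hx
  let R : E →ₗ[ℝ] E := S.starProjection
  have hRS : ∀ x, R x ∈ S := fun x => Submodule.starProjection_apply_mem _ x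
  have hRid : ∀ x ∈ S, R x = x := fun x hx => Submodule.starProjection_eq_self_iff.2 hx
  by_cases hKS : (K : Set E) ⊆ S
  · exact exists_projection_of_mapsTo R hFK hRS
      (fun x hx => hF.mem_of_mem_span (by rw [hRid x (hKS hx)]; exact hx) (hRS x))
      fun x hx => hRid x (hFS x hx)
  obtain ⟨w, hwK, hwS⟩ := Set.not_subset.1 hKS
  obtain ⟨h, hhw, hhS⟩ : ∃ h : E →ₗ[ℝ] ℝ, h w = 1 ∧ ∀ x ∈ S, h x = 0 := by
    obtain ⟨h, hw, hle⟩ := Submodule.exists_le_ker_of_notMem hwS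
    exact ⟨(h w)⁻¹ • h, by simp [hw], fun x hx => by
      simp [LinearMap.mem_ker.1 (hle hx)]⟩
  -- by the dimension count, `S` and `w` span the cone
  have hdec : ∀ x ∈ K, x - h x • w ∈ S := by
    have hle : S ⊔ Submodule.span ℝ {w} ≤ Submodule.span ℝ (K : Set E) :=
      sup_le (Submodule.span_mono hFK) (Submodule.span_le.2 (by
        simpa using Submodule.subset_span hwK))
    have hlt : S < S ⊔ Submodule.span ℝ {w} :=
      lt_of_le_of_ne le_sup_left fun heq => hwS (heq ▸ Submodule.mem_sup_right
        (Submodule.mem_span_singleton_self w))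
    have heq := Submodule.eq_of_le_of_finrank_le hle
      (hdim.trans (Submodule.finrank_lt_finrank_of_lt hlt))
    intro x hx
    have hx' : x ∈ S ⊔ Submodule.span ℝ {w} := heq ▸ Submodule.subset_span hx
    obtain ⟨y, hy, z, hz, rfl⟩ := Submodule.mem_sup.1 hx'
    obtain ⟨c, rfl⟩ := Submodule.mem_span_singleton.1 hz
    simpa [hhS y hy, hhw] using hy
  have hnonneg : ∀ x ∈ K, 0 ≤ h x := by
    intro x hx
    by_contra! hlt
    have h1 : (-h x) • w ∈ K := K.smul_mem hwK (neg_nonneg.2 hlt.le)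
    have h2 : x - h x • w = (-h x) • w + x := by module
    have h3 : (-h x) • w + x ∈ F :=
      hF.mem_of_mem_span (add_mem h1 hx) (h2 ▸ hdec x hx)
    exact hwS (hFS w (mem_of_smul_mem (neg_pos.2 hlt) (hF.mem_of_add_mem h1 hx h3)))
  obtain ⟨u, huF, M, hM, hu⟩ := exists_add_smul_mem F
  -- the image of `x ∈ K` under `x ↦ x - h x • w` is within `κ * (h x * ‖w‖)` of the face
  let t : ℝ := M * (κ * ‖w‖)
  let P : E →ₗ[ℝ] E := R ∘ₗ (LinearMap.id - h.smulRight (w - t • u))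
  have hP : ∀ x, P x = R (x - h x • (w - t • u)) := fun x => by simp [P]
  refine exists_projection_of_mapsTo P hFK (fun x => hRS _) (fun x hx => ?_) fun x hx => ?_
  · set y := x - h x • w with hy
    have hyS : y ∈ S := hdec x hx
    have hxy : x - h x • (w - t • u) = y + (h x * t) • u := by
      rw [hy]
      module
    rw [hP, hxy, hRid _ (add_mem hyS (Submodule.smul_mem _ _ (hFS u huF)))]
    obtain ⟨z, hz, hyz⟩ := F.isClosed.exists_infDist_eq_dist F.nonempty y
    have hdist : ‖y - z‖ ≤ κ * (h x * ‖w‖) := by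
      rw [← dist_eq_norm, ← hyz]
      refine (hκ y hyS).trans (mul_le_mul_of_nonneg_left ?_ hκ₀)
      refine (Metric.infDist_le_dist_of_mem (show x ∈ (K : Set E) from hx)).trans_eq ?_
      rw [dist_eq_norm, hy, sub_sub_cancel_left, norm_neg, norm_smul,
        Real.norm_of_nonneg (hnonneg x hx)]
    have hmem := hu (y - z) (sub_mem hyS (hFS z hz)) (h x * t) (by
      calc M * ‖y - z‖ ≤ M * (κ * (h x * ‖w‖)) := by gcongr
        _ = h x * t := by simp only [t]; ring)
    have := add_mem hz hmem
    rwa [← add_assoc, add_sub_cancel] at this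
  · rw [hP, hhS x (hFS x hx), zero_smul, sub_zero, hRid x (hFS x hx)]

/-! ### Amenability and projectional exposure in low dimension -/

lemma IsAmenable.isProjectionallyExposed {K : ProperCone ℝ E} (hdim : coneDim K ≤ 4)
    (hK : IsAmenable K) : IsProjectionallyExposed K := by
  intro F hF
  obtain ⟨κ, hκ₀, hκ⟩ := hK F hF
  obtain ⟨F, rfl⟩ := hF.exists_properCone
  -- the span of a face with pointed part of dimension at least three has codimension at most one
  rcases le_or_gt (Module.finrank ℝ (Submodule.span ℝ (pointedPart F : Set E))) 2 with h2 | h3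
  · exact exists_projection_of_finrank_pointedPart_le hκ₀.le hF.isExtreme.subset hκ h2
  · refine exists_projection_of_finrank_le_succ hκ₀.le hF hκ ?_
    have hle : Module.finrank ℝ (Submodule.span ℝ (pointedPart F : Set E)) ≤ coneDim F :=
      Submodule.finrank_mono (Submodule.span_mono fun x hx => hx.1)
    omega

end AmenableCones

theorem mainTheorem3 {E : Type*} [NormedAddCommGroup E] [InnerProductSpace ℝ E]
    [FiniteDimensional ℝ E] (K : ProperCone ℝ E) :
    (AmenableCones.coneDim K ≤ 4 →
      (AmenableCones.IsAmenable K ↔ AmenableCones.IsProjectionallyExposed K)) ∧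
    (AmenableCones.IsAmenable K → ¬ AmenableCones.IsProjectionallyExposed K →
      5 ≤ AmenableCones.coneDim K) := by
  refine ⟨fun hdim => ⟨fun hK => hK.isProjectionallyExposed hdim, fun hK => hK.isAmenable⟩,
    fun hK hnot => ?_⟩
  by_contra! hlt
  exact hnot (hK.isProjectionallyExposed (by omega))
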